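/- Let $X$ be a Noetherian scheme and $Z\subset X$ a closed, nowhere dense subscheme. A \emph{universal homeomorphism} is a morphism of schemes all of whose base changes are homeomorphisms. For a finite morphism $p:Y\to X$ put $Z_Y:=p^{-1}(Z)$, and call $p$ (i) a \emph{finite modification of $X$ centered at $Z$} if no associated point of $Y$ lies in $Z_Y$ and $p|_{Y\setminus Z_Y}:Y\setminus Z_Y\to X\setminus Z$ is an isomorphism; (ii) a \emph{finite topological modification of $X$ centered at $Z$} if no associated point of $Y$ lies in $Z_Y$ and $p|_{Y\setminus Z_Y}:Y\setminus Z_Y\to X\setminus Z$ is a universal homeomorphism. The pair $Z\subset X$ is \emph{topologically normal} (TN) if every finite modification of $X$ centered at $Z$ is a universal homeomorphism, and \emph{strongly topologically normal} (STN) if every finite topological modification of $X$ centered at $Z$ is a universal homeomorphism. Then $Z\subset X$ is topologically normal if and only if it is strongly topologically normal. -/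

import Mathlib

open CategoryTheory AlgebraicGeometry

universe u

namespace NormalPairs

/-- A morphism of schemes is a universal homeomorphism if every base change of it
is a homeomorphism on the underlying topological spaces. -/
def IsUniversalHomeomorphism {X Y : Scheme.{u}} (f : X ⟶ Y) : Prop :=
  MorphismProperty.universally (AlgebraicGeometry.topologically IsHomeomorph) f

/-- The open complement `X \ Z` of a closed subscheme `i : Z ⟶ X`. -/
def openComplement {Z X : Scheme.{u}} (i : Z ⟶ X) [IsClosedImmersion i] : X.Opens :=
  ⟨(Set.range i)ᶜ, i.isClosedEmbedding.isClosed_range.isOpen_compl⟩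

/-- A point `y` of a locally Noetherian scheme `Y` is an associated point if the maximal ideal of
the local ring at `y` is an associated prime of this local ring. -/
def IsAssociatedPoint {Y : Scheme.{u}} (y : Y) : Prop :=
  IsAssociatedPrime (IsLocalRing.maximalIdeal (Y.presheaf.stalk y)) (Y.presheaf.stalk y)

/-- A finite modification of `X` centered at the closed subscheme `i : Z ⟶ X`: a finite
morphism `p : Y ⟶ X` such that no associated point of `Y` lies over `Z`, and `p` restricts to an
isomorphism over `X \ Z`. -/
structure IsFiniteModification {Z X Y : Scheme.{u}} (i : Z ⟶ X) [IsClosedImmersion i]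
    (p : Y ⟶ X) : Prop where
  isFinite : IsFinite p
  not_mem_of_isAssociatedPoint : ∀ y : Y, IsAssociatedPoint y → p y ∉ Set.range i
  isIso_restrict : IsIso (p ∣_ openComplement i)

/-- A finite topological modification of `X` centered at the closed subscheme `i : Z ⟶ X`: a
finite morphism `p : Y ⟶ X` such that no associated point of `Y` lies over `Z`, and `p` restricts
to a universal homeomorphism over `X \ Z`. -/
structure IsFiniteTopologicalModification {Z X Y : Scheme.{u}} (i : Z ⟶ X) [IsClosedImmersion i]
    (p : Y ⟶ X) : Prop where
  isFinite : IsFinite p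
  not_mem_of_isAssociatedPoint : ∀ y : Y, IsAssociatedPoint y → p y ∉ Set.range i
  isUniversalHomeomorphism_restrict : IsUniversalHomeomorphism (p ∣_ openComplement i)

/-- Property TN of the pair `Z ⊂ X`: every finite modification of `X` centered at `Z` is a
universal homeomorphism. -/
def IsTopologicallyNormalPair {Z X : Scheme.{u}} (i : Z ⟶ X) [IsClosedImmersion i] : Prop :=
  ∀ ⦃Y : Scheme.{u}⦄ (p : Y ⟶ X), IsFiniteModification i p → IsUniversalHomeomorphism p

/-- Property STN of the pair `Z ⊂ X`: every finite topological modification of `X` centered at `Z`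
is a universal homeomorphism. -/
def IsStronglyTopologicallyNormalPair {Z X : Scheme.{u}} (i : Z ⟶ X) [IsClosedImmersion i] :
    Prop :=
  ∀ ⦃Y : Scheme.{u}⦄ (p : Y ⟶ X),
    IsFiniteTopologicalModification i p → IsUniversalHomeomorphism p

end NormalPairs

/-!
Strong topological normality implies topological normality because an isomorphism is a universal
homeomorphism. For the converse let `U = X \ Z`, let `f : U ⟶ X` be the inclusion and let `N` be the
normalization of `X` in `U`, which is integral over `X` but in general not finite.

*The morphism `N ⟶ X` is a universal homeomorphism.* Over an affine open `W` with `A = Γ(X, W)` and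
`G = Γ(U, U ∩ W)`, the ring of `N` is the integral closure of `A` in `G`. It is the increasing union
of the subalgebras `boundedIntegralClosure A G (J ^ n)` generated by the integral sections whose
denominators contain `J ^ n`, where `J` is the ideal of `Z`. A section killed by `J` vanishes on
`U`, so these subalgebras are finite over `A` (`finite_boundedIntegralClosure`) and have no
associated prime over `Z`; they are compatible with localization
(`isLocalization_boundedIntegralClosure`), so for each `n` they glue to a finite modification of `X`
centered at `Z`. Topological normality makes it radicial, so two homomorphisms from the ring of `N`
to a field that agree on `A` are equal.

*A finite topological modification `p : Y ⟶ X` is radicial.* The set of clopen subsets does not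
change along any of the morphisms `p⁻¹(U) ⟶ U ⟶ N ⟶ X`: the outer two are homeomorphisms, and a
clopen subset of `U` extends to `N` by the universal property of the normalization applied to the
morphism `U ⟶ X ⨿ X` it defines. Since `p⁻¹(U)` is dense in `Y`, every clopen subset of `Y` is the
preimage of one of `X`. All of this survives étale base change, as normalization does
(`exists_isClopen_preimage_eq_of_etale`). But a finite morphism that is not radicial acquires, after
some étale base change `X' ⟶ X`, a clopen subset upstairs that is not a preimage
(`eq_of_comap_injective_of_etale` and `comap_injective_of_isIdempotentElem`).

Finally `p` is surjective, its closed image containing the dense set `U`, and a finite, radicial and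
surjective morphism is a universal homeomorphism.
-/

namespace NormalPairs

/-! ### Detecting radicial ring maps by étale base change -/

section Ring

open Polynomial TensorProduct

universe v

/-- A separable element `γ` over the fraction field `κ` of the image of `A` in `K` lies, up to a
nonzero scalar from `A`, in the image of an étale `A`-algebra: clear denominators in its minimal
polynomial and take the standard étale algebra on which the derivative is inverted. -/
theorem exists_etale_algHom_eq {A : Type v} [CommRing A] {K : Type*} [Field K]
    [Algebra A K] (κ : Type*) [Field κ] [Algebra A κ] [Algebra κ K] [IsScalarTower A κ K]
    [Algebra (A ⧸ RingHom.ker (algebraMap A K)) κ]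
    [IsScalarTower A (A ⧸ RingHom.ker (algebraMap A K)) κ]
    [IsFractionRing (A ⧸ RingHom.ker (algebraMap A K)) κ]
    (γ : K) (hγ : IsSeparable κ γ) :
    ∃ (E : Type v) (_ : CommRing E) (_ : Algebra A E) (_ : Algebra.Etale A E) (φ : E →ₐ[A] K)
      (x : E) (s : A), algebraMap A K s ≠ 0 ∧ φ x = algebraMap A K s * γ := by
  have hint : IsIntegral κ γ := hγ.isIntegral
  set M := nonZeroDivisors (A ⧸ RingHom.ker (algebraMap A K))
  set μ := minpoly κ γ
  have hμ : μ.Monic := minpoly.monic hint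
  set c : M := IsLocalization.commonDenom M μ.support μ.coeff
  obtain ⟨s, hs⟩ := Ideal.Quotient.mk_surjective (c : A ⧸ RingHom.ker (algebraMap A K))
  have hsκ : algebraMap A κ s = algebraMap (A ⧸ RingHom.ker (algebraMap A K)) κ c := by
    rw [← hs, IsScalarTower.algebraMap_apply A (A ⧸ RingHom.ker (algebraMap A K)) κ]; rfl
  have hs0 : algebraMap A κ s ≠ 0 := by
    rw [hsκ]; exact (IsLocalization.map_units κ c).ne_zero
  have hsK : algebraMap A K s ≠ 0 := by
    rw [IsScalarTower.algebraMap_apply A κ K]; simpa using hs0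
  obtain ⟨F₀, hF₀, -, hF₀m⟩ := lifts_and_natDegree_eq_and_monic
    (IsLocalization.scaleRoots_commonDenom_mem_lifts M μ (by rw [hμ.leadingCoeff]; exact one_mem _))
    ((monic_scaleRoots_iff _).mpr hμ)
  obtain ⟨F, hF, -, hFm⟩ := lifts_and_natDegree_eq_and_monic
    (f := Ideal.Quotient.mk (RingHom.ker (algebraMap A K))) (p := F₀)
    ((mem_lifts _).mpr (map_surjective _ Ideal.Quotient.mk_surjective F₀)) hF₀m
  have hFκ : F.map (algebraMap A κ) = μ.scaleRoots (algebraMap A κ s) := by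
    rw [hsκ, ← hF₀, ← hF, Polynomial.map_map,
      IsScalarTower.algebraMap_eq A (A ⧸ RingHom.ker (algebraMap A K)) κ]; rfl
  have hcomp : (F.map (algebraMap A κ)).comp (C (algebraMap A κ s) * X) =
      C (algebraMap A κ s ^ μ.natDegree) * μ := by
    rw [hFκ, comp, scaleRoots_eval₂_mul, eval₂_C_X, C_pow]
  have hroot : aeval (algebraMap A K s * γ) F = 0 := by
    have := congr(aeval γ $hcomp)
    simpa [aeval_comp, μ, aeval_map_algebraMap, ← IsScalarTower.algebraMap_apply] using this
  have hder : aeval (algebraMap A K s * γ) (derivative F) ≠ 0 := by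
    have := congr(aeval γ (derivative $hcomp))
    have h2 : aeval γ (derivative μ) ≠ 0 :=
      hγ.aeval_derivative_ne_zero (minpoly.aeval κ γ)
    intro h
    rw [derivative_comp, derivative_C_mul, derivative_C_mul, derivative_X] at this
    simp [aeval_comp, derivative_map, aeval_map_algebraMap, ← IsScalarTower.algebraMap_apply, h,
      h2, hsK] at this
  let P : StandardEtalePair A := ⟨F, hFm, derivative F, 1, 0, 1, by simp⟩
  exact ⟨P.Ring, inferInstance, inferInstance, inferInstance,
    P.lift (algebraMap A K s * γ) ⟨hroot, hder.isUnit⟩, P.X, s, hsK, P.lift_X _ _⟩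

/-- If `Spec B ⟶ Spec A` is integral and stays injective after every étale base change, then it is
radicial. If `g₁ b ≠ g₂ b`, some `p ^ n`-th power of `g₁ b` is separable over the residue field of
`A`, hence comes from an étale algebra `E`; as `g₁` and `g₂` induce the same prime of `E ⊗ B`, they
agree on that power of `b`, hence on `b`. -/
theorem eq_of_comap_injective_of_etale {A B : Type v} [CommRing A] [CommRing B] [Algebra A B]
    [Algebra.IsIntegral A B]
    (H : ∀ (E : Type v) [CommRing E] [Algebra A E] [Algebra.Etale A E],
      Function.Injective (PrimeSpectrum.comap (algebraMap E (E ⊗[A] B))))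
    {K : Type*} [Field K] [Algebra A K] (g₁ g₂ : B →ₐ[A] K) : g₁ = g₂ := by
  ext b
  by_contra hne
  let p := RingHom.ker (algebraMap A K)
  have : p.IsPrime := RingHom.ker_isPrime _
  let κ := p.ResidueField
  have hp : p.primeCompl ≤ Submonoid.comap (algebraMap A K) (IsUnit.submonoid K) :=
    fun a ha ↦ (show algebraMap A K a ≠ 0 from ha).isUnit
  let i : κ →ₐ[A] K := Ideal.ResidueField.liftₐ p (Algebra.ofId A K) le_rfl hp
  let := i.toRingHom.toAlgebra
  have : IsScalarTower A κ K := .of_algebraMap_eq' i.comp_algebraMap.symm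
  set q := ringExpChar κ
  have : ExpChar K q := expChar_of_injective_algebraMap (algebraMap κ K).injective q
  have hint : IsIntegral κ (g₁ b) := ((Algebra.IsIntegral.isIntegral (R := A) b).map g₁).tower_top
  obtain ⟨g, hg, n, hn⟩ := (minpoly.irreducible hint).hasSeparableContraction q
  have hsep : IsSeparable κ (g₁ b ^ q ^ n) := by
    refine hg.of_dvd (minpoly.dvd _ _ ?_)
    rw [← expand_aeval, hn, minpoly.aeval]
  obtain ⟨E, _, _, _, φ, x, s, hs, hx⟩ := exists_etale_algHom_eq (A := A) κ _ hsep
  let h (g : B →ₐ[A] K) : E ⊗[A] B →ₐ[A] K := Algebra.TensorProduct.productMap φ g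
  let P (g : B →ₐ[A] K) : PrimeSpectrum (E ⊗[A] B) := ⟨RingHom.ker (h g), RingHom.ker_isPrime _⟩
  have hP : P g₁ = P g₂ := by
    apply H E
    ext y
    simp [P, h, RingHom.mem_ker]
  have h1 : x ⊗ₜ 1 - 1 ⊗ₜ[A] (s • b ^ q ^ n) ∈ (P g₁).asIdeal := by
    simp [P, h, RingHom.mem_ker, hx, Algebra.smul_def]
  rw [hP] at h1
  simp only [P, h, RingHom.mem_ker, map_sub, Algebra.TensorProduct.productMap_apply_tmul, map_one,
    mul_one, one_mul, hx, map_mul, map_pow, Algebra.smul_def, AlgHom.commutes, sub_eq_zero] at h1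
  exact hne (iterateFrobenius_inj K q n (mul_left_cancel₀ hs h1))

/-- Let `B` be finite over `A`. If, after every étale base change, idempotents upstairs do not
separate primes with the same image, then `Spec B ⟶ Spec A` is injective after every étale base
change. The reason is that distinct primes in a fibre of a finite algebra are separated by an
idempotent after passing to an étale neighbourhood. -/
theorem comap_injective_of_isIdempotentElem {A B : Type v} [CommRing A] [CommRing B] [Algebra A B]
    [Module.Finite A B]
    (H : ∀ (E : Type v) [CommRing E] [Algebra A E] [Algebra.Etale A E] (e : E ⊗[A] B),
      IsIdempotentElem e → ∀ P Q : PrimeSpectrum (E ⊗[A] B),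
        P.comap (algebraMap E (E ⊗[A] B)) = Q.comap (algebraMap E (E ⊗[A] B)) →
          e ∈ P.asIdeal → e ∈ Q.asIdeal)
    (E : Type v) [CommRing E] [Algebra A E] [Algebra.Etale A E] :
    Function.Injective (PrimeSpectrum.comap (algebraMap E (E ⊗[A] B))) := by
  intro Q₁ Q₂ hQ
  let p := (Q₁.comap (algebraMap E (E ⊗[A] B)))
  have : Q₁.asIdeal.LiesOver p.asIdeal := ⟨rfl⟩
  have : Q₂.asIdeal.LiesOver p.asIdeal := ⟨congr($(hQ).asIdeal)⟩
  -- After an étale extension `E'`, an idempotent `e` singles out one prime `P'` of the fibre over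
  -- `P`, and this prime lies over `Q₁`.
  obtain ⟨E', _, _, _, P, _, hPp, e, he, P', _, hP'P, hP'Q, heP', hbij, -, huniq⟩ :=
    Algebra.exists_etale_isIdempotentElem_forall_liesOver_eq p.asIdeal Q₁.asIdeal
  -- As `E'` has trivial residue extension at `P`, there is also a prime `P''` over `P` and `Q₂`.
  let κ := Q₂.asIdeal.ResidueField
  let ι := AlgEquiv.ofBijective _ hbij
  let ρ : E' →ₐ[E] κ := ((Ideal.ResidueField.mapₐ p.asIdeal Q₂.asIdeal
    (Algebra.ofId _ _) (Q₂.asIdeal.over_def p.asIdeal)).comp ι.symm.toAlgHom).comp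
      (IsScalarTower.toAlgHom E E' P.ResidueField)
  let h : E' ⊗[E] (E ⊗[A] B) →ₐ[E] κ :=
    Algebra.TensorProduct.productMap ρ (IsScalarTower.toAlgHom E (E ⊗[A] B) κ)
  let P'' : Ideal (E' ⊗[E] (E ⊗[A] B)) := RingHom.ker h
  have : P''.IsPrime := RingHom.ker_isPrime _
  have hP'' : P = P''.comap (algebraMap E' _) := by
    ext y
    simp [P'', h, RingHom.mem_ker, ρ]
  have hQ'' : P''.comap Algebra.TensorProduct.includeRight.toRingHom = Q₂.asIdeal := by
    ext y
    simpa [P'', h, RingHom.mem_ker] using Ideal.algebraMap_residueField_eq_zero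
  let : Algebra A E' := ((algebraMap E E').comp (algebraMap A E)).toAlgebra
  have : IsScalarTower A E E' := .of_algebraMap_eq' rfl
  have : Algebra.Etale A E' := .comp A E E'
  let c : E' ⊗[E] (E ⊗[A] B) ≃ₐ[E'] E' ⊗[A] B := Algebra.TensorProduct.cancelBaseChange A E E' E' B
  by_contra hne
  have heP'' : e ∈ P'' := by
    by_contra h
    have := huniq P'' inferInstance ⟨hP''⟩ h
    apply hne
    ext1
    rw [← hQ'', this, hP'Q]
  refine heP' ?_
  have key := H E' (c e) (he.map c) ⟨P''.comap c.symm.toRingHom, inferInstance⟩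
    ⟨P'.comap c.symm.toRingHom, inferInstance⟩ ?_ (by simpa using heP'')
  · simpa using key
  · ext y
    have h1 := hP''
    rw [hP'P.over] at h1
    have h2 : c.symm (y ⊗ₜ 1) = y ⊗ₜ 1 := c.symm.commutes y
    simpa [h2] using congr(y ∈ $h1).symm

end Ring

/-! ### Radicial morphisms on affine opens -/

section UniversallyInjective

variable {X Y : Scheme.{u}}

theorem exists_specMap_comp_fromSpec_eq {V : X.Opens} (hV : IsAffineOpen V) {K : Type u} [Field K]
    (g : Spec (.of K) ⟶ X) (h : g (IsLocalRing.closedPoint K) ∈ V) :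
    ∃ φ : Γ(X, V) ⟶ .of K, g = Spec.map φ ≫ hV.fromSpec := by
  have hr : Set.range g ⊆ Set.range hV.fromSpec := by
    rintro _ ⟨x, rfl⟩
    rw [hV.range_fromSpec, Subsingleton.elim (α := PrimeSpectrum K) x (IsLocalRing.closedPoint K)]
    exact h
  exact ⟨Spec.preimage (IsOpenImmersion.lift hV.fromSpec g hr), by simp⟩

/-- A morphism is radicial as soon as it is injective on points with values in algebraically closed
fields; for an affine morphism these can be tested on rings of sections. -/
theorem universallyInjective_of_forall_isAffineOpen (p : Y ⟶ X) [IsAffineHom p]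
    (H : ∀ V : X.Opens, IsAffineOpen V → ∀ (K : Type u) [Field K] [IsAlgClosed K]
      (g₁ g₂ : Γ(Y, p ⁻¹ᵁ V) ⟶ .of K), p.app V ≫ g₁ = p.app V ≫ g₂ → g₁ = g₂) :
    UniversallyInjective p := by
  refine ((tfae_universallyInjective p).out 0 1).mpr ?_
  intro K _ g₁ g₂ hg
  obtain ⟨_, ⟨V, hV, rfl⟩, hxV, -⟩ := X.isBasis_affineOpens.exists_subset_of_mem_open
    (Set.mem_univ ((g₁ ≫ p) (IsLocalRing.closedPoint K))) isOpen_univ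
  replace hV : IsAffineOpen V := hV
  have hW : IsAffineOpen (p ⁻¹ᵁ V) := hV.preimage p
  dsimp only at hg
  obtain ⟨φ₁, h₁⟩ := exists_specMap_comp_fromSpec_eq hW g₁ hxV
  obtain ⟨φ₂, h₂⟩ := exists_specMap_comp_fromSpec_eq hW g₂ (by rw [hg] at hxV; exact hxV)
  have key : p.app V ≫ φ₁ = p.app V ≫ φ₂ := by
    apply Spec.map_injective
    rw [← cancel_mono hV.fromSpec]
    rw [h₁, h₂, Category.assoc, Category.assoc, ← hV.SpecMap_appLE_fromSpec p hW le_rfl] at hg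
    simpa [Scheme.Hom.app_eq_appLE] using hg
  -- Injectivity over the algebraic closure of `K` gives injectivity over `K`.
  let j : CommRingCat.of K ⟶ .of (AlgebraicClosure K) := CommRingCat.ofHom (algebraMap K _)
  have : Mono j :=
    ConcreteCategory.mono_of_injective _ (algebraMap K (AlgebraicClosure K)).injective
  rw [h₁, h₂, ← cancel_mono j |>.mp (H V hV (AlgebraicClosure K) (φ₁ ≫ j) (φ₂ ≫ j)
    (by rw [reassoc_of% key]))]

theorem app_comp_injective (p : Y ⟶ X) [IsAffineHom p] [UniversallyInjective p] {V : X.Opens}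
    (hV : IsAffineOpen V) {K : Type u} [Field K] (g₁ g₂ : Γ(Y, p ⁻¹ᵁ V) ⟶ .of K)
    (h : p.app V ≫ g₁ = p.app V ≫ g₂) : g₁ = g₂ := by
  have hW : IsAffineOpen (p ⁻¹ᵁ V) := hV.preimage p
  apply Spec.map_injective
  rw [← cancel_mono hW.fromSpec]
  have H : ∀ (K : Type u) [Field K], Function.Injective (fun g : Spec (.of K) ⟶ Y ↦ g ≫ p)  :=
    ((tfae_universallyInjective p).out 0 1).mp ‹UniversallyInjective p›
  apply H K
  simp only [Category.assoc, ← hV.SpecMap_appLE_fromSpec p hW le_rfl, ← Spec.map_comp_assoc,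
    ← Scheme.Hom.app_eq_appLE, h]

end UniversallyInjective

/-! ### Universal homeomorphisms -/

section UniversalHomeomorphism

variable {X Y : Scheme.{u}}

theorem isUniversalHomeomorphism_of_isIso (f : X ⟶ Y) [IsIso f] : IsUniversalHomeomorphism f := by
  intro X' Y' i₁ i₂ f' h
  have : IsIso f' := (MorphismProperty.isomorphisms Scheme).of_isPullback h.flip ‹_›
  exact f'.homeomorph.isHomeomorph

theorem IsUniversalHomeomorphism.isHomeomorph {f : X ⟶ Y} (hf : IsUniversalHomeomorphism f) :
    IsHomeomorph f :=
  hf _ _ _ .of_id_snd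

theorem IsUniversalHomeomorphism.universallyInjective {f : X ⟶ Y}
    (hf : IsUniversalHomeomorphism f) : UniversallyInjective f :=
  ⟨MorphismProperty.universally_mono (fun _ _ _ h ↦ h.injective) _ hf⟩

theorem isUniversalHomeomorphism_of_universallyInjective (f : X ⟶ Y) [IsIntegralHom f]
    [UniversallyInjective f] [Surjective f] : IsUniversalHomeomorphism f := by
  intro X' Y' i₁ i₂ f' h
  have : UniversallyInjective f' := MorphismProperty.of_isPullback h.flip ‹_›
  have : Surjective f' := MorphismProperty.of_isPullback h.flip ‹_›
  have : IsIntegralHom f' := MorphismProperty.of_isPullback h.flip ‹_›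
  exact isHomeomorph_iff_continuous_isClosedMap_bijective.mpr
    ⟨f'.continuous, f'.isClosedMap, f'.injective, f'.surjective⟩

end UniversalHomeomorphism

/-! ### Clopen subsets and normalization -/

section Clopen

open Limits

variable {X Y U : Scheme.{u}}

/-- A clopen subset of `U` extends to a clopen subset of the normalization: it defines a morphism `U
⟶ X ⨿ X` over `X`, and since `X ⨿ X` is integral over `X` this factors through the normalization. -/
theorem exists_isClopen_preimage_toNormalization (f : U ⟶ X) [QuasiCompact f] [QuasiSeparated f]
    {W : Set U} (hW : IsClopen W) :
    ∃ W' : Set f.normalization, IsClopen W' ∧ f.toNormalization ⁻¹' W' = W := by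
  let V₁ : U.Opens := ⟨W, hW.isOpen⟩
  let V₂ : U.Opens := ⟨Wᶜ, hW.compl.isOpen⟩
  have hcompl : IsCompl V₁.ι.opensRange V₂.ι.opensRange := by
    simp [isCompl_iff, disjoint_iff, codisjoint_iff, SetLike.ext'_iff, V₁, V₂]
  obtain ⟨H⟩ := nonempty_isColimit_binaryCofanMk_of_isCompl V₁.ι V₂.ι hcompl
  let f₁ : U ⟶ X ⨿ X := H.desc (BinaryCofan.mk ((V₁.ι ≫ f) ≫ coprod.inl) ((V₂.ι ≫ f) ≫ coprod.inr))
  have h₁ : V₁.ι ≫ f₁ = (V₁.ι ≫ f) ≫ coprod.inl := H.fac _ ⟨.left⟩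
  have h₂ : V₂.ι ≫ f₁ = (V₂.ι ≫ f) ≫ coprod.inr := H.fac _ ⟨.right⟩
  have hf : f = f₁ ≫ coprod.desc (𝟙 X) (𝟙 X) := by
    refine BinaryCofan.IsColimit.hom_ext H ?_ ?_
    · refine Eq.trans ?_ (congr($h₁ ≫ coprod.desc (𝟙 X) (𝟙 X))).symm
      rw [Category.assoc, coprod.inl_desc, Category.comp_id]; rfl
    · refine Eq.trans ?_ (congr($h₂ ≫ coprod.desc (𝟙 X) (𝟙 X))).symm
      rw [Category.assoc, coprod.inr_desc, Category.comp_id]; rfl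
  let d := f.normalizationDesc f₁ (coprod.desc (𝟙 X) (𝟙 X)) hf
  have hcl : IsClopen (Set.range (coprod.inl : X ⟶ X ⨿ X)) := by
    refine ⟨?_, (coprod.inl : X ⟶ X ⨿ X).isOpenEmbedding.isOpen_range⟩
    rw [← isOpen_compl_iff, (isCompl_range_inl_inr X X).compl_eq]
    exact (coprod.inr : X ⟶ X ⨿ X).isOpenEmbedding.isOpen_range
  refine ⟨d ⁻¹' Set.range (coprod.inl : X ⟶ X ⨿ X), hcl.preimage d.continuous, ?_⟩
  ext x
  have hx : d (f.toNormalization x) = f₁ x := by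
    rw [← Scheme.Hom.comp_apply, Scheme.Hom.toNormalization_normalizationDesc]
  rw [Set.mem_preimage, Set.mem_preimage, hx]
  constructor
  · intro hx
    by_contra hxW
    let y : V₂ := ⟨x, hxW⟩
    have : f₁ x ∈ Set.range (coprod.inr : X ⟶ X ⨿ X) := ⟨(V₂.ι ≫ f) y, congr($h₂ y).symm⟩
    exact Set.disjoint_left.mp (isCompl_range_inl_inr X X).disjoint hx this
  · intro hxW
    let y : V₁ := ⟨x, hxW⟩
    exact ⟨(V₁.ι ≫ f) y, congr($h₁ y).symm⟩

/-- If the normalization of `X` in `U` is homeomorphic to `X`, and a scheme `P` homeomorphic to `U`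
maps over `X` onto a dense subset of `Y`, then all clopen subsets of `Y` come from `X`. -/
theorem exists_isClopen_preimage_eq {P : Scheme.{u}} (f : U ⟶ X) [QuasiCompact f]
    [QuasiSeparated f] (hf : IsHomeomorph f.fromNormalization) (p : Y ⟶ X) (a : P ⟶ Y) (b : P ⟶ U)
    (hb : IsHomeomorph b) (ha : DenseRange a) (h : a ≫ p = b ≫ f) {V : Set Y} (hV : IsClopen V) :
    ∃ W : Set X, IsClopen W ∧ p ⁻¹' W = V := by
  let e := hb.homeomorph
  -- Transport `V` to `U` along `b`, extend it to the normalization and move it to `X`.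
  obtain ⟨W₁, hW₁, hW₁'⟩ := exists_isClopen_preimage_toNormalization f
    ((hV.preimage a.continuous).preimage e.symm.continuous)
  let e' := hf.homeomorph
  refine ⟨e'.symm ⁻¹' W₁, hW₁.preimage e'.symm.continuous, ?_⟩
  have hW : IsClopen (p ⁻¹' (e'.symm ⁻¹' W₁)) :=
    (hW₁.preimage e'.symm.continuous).preimage p.continuous
  -- Both sets are clopen, so it is enough to compare them on the dense image of `P`.
  have key (x : P) : a x ∈ p ⁻¹' (e'.symm ⁻¹' W₁) ↔ a x ∈ V := by
    have h1 : p (a x) = e' (f.toNormalization (b x)) := by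
      change _ = f.fromNormalization _
      rw [← Scheme.Hom.comp_apply, ← Scheme.Hom.comp_apply,
        Scheme.Hom.toNormalization_fromNormalization, h, Scheme.Hom.comp_apply]
    have h2 : b x ∈ f.toNormalization ⁻¹' W₁ ↔ a x ∈ V := by
      rw [hW₁', Set.mem_preimage, Set.mem_preimage,
        show e.symm (b x) = x from e.symm_apply_apply x]
    rw [Set.mem_preimage, h1, Set.mem_preimage, e'.symm_apply_apply]
    exact h2
  have sub {S T : Set Y} (hS : IsClopen S) (hT : IsClopen T) (hST : ∀ x, a x ∈ S → a x ∈ T) :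
      S ⊆ T := by
    by_contra hne
    obtain ⟨y, hyS, hyT⟩ := Set.not_subset.mp hne
    obtain ⟨x, hx⟩ := ha.exists_mem_open (hS.isOpen.inter hT.compl.isOpen) ⟨y, hyS, hyT⟩
    exact hx.2 (hST x hx.1)
  exact (sub hW hV fun x ↦ (key x).mp).antisymm (sub hV hW fun x ↦ (key x).mpr)

theorem exists_isClopen_preimage_eq_of_etale (f : U ⟶ X) [IsOpenImmersion f] [QuasiCompact f]
    (hf : IsUniversalHomeomorphism f.fromNormalization) (p : Y ⟶ X)
    (hp : IsUniversalHomeomorphism (pullback.snd p f)) (hd : Dense (p ⁻¹' Set.range f))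
    {X' Y' : Scheme.{u}} {g : X' ⟶ X} [Etale g] {p' : Y' ⟶ X'} {g' : Y' ⟶ Y}
    (h : IsPullback g' p' p g) {V : Set Y'} (hV : IsClopen V) :
    ∃ W : Set X', IsClopen W ∧ p' ⁻¹' W = V := by
  let f' := pullback.snd f g
  have hg' : Etale g' := MorphismProperty.of_isPullback h.flip ‹_›
  refine exists_isClopen_preimage_eq f' ?_ p' (pullback.fst p' f') (pullback.snd p' f') ?_ ?_
    pullback.condition hV
  · have h1 : IsHomeomorph (pullback.snd f.fromNormalization g) := 
      hf _ _ _ (IsPullback.of_hasPullback _ _).flip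
    have h2 := (f.normalizationPullback g).homeomorph.isHomeomorph
    have h3 : f'.fromNormalization = f.normalizationPullback g ≫ pullback.snd _ _ := by simp [f']
    rw [h3]
    exact h1.comp h2
  · have h1 : IsPullback (pullback.fst p' f' ≫ g') (pullback.snd p' f') p (f' ≫ g) :=
      (IsPullback.of_hasPullback p' f').flip.paste_vert h.flip |>.flip
    rw [← pullback.condition] at h1
    have h2 := IsPullback.of_right' h1 (IsPullback.of_hasPullback p f)
    exact hp _ _ _ h2.flip
  · rw [DenseRange]
    have : Set.range (pullback.fst p' f') = g' ⁻¹' (p ⁻¹' Set.range f) := by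
      have hw (y : Y') : g (p' y) = p (g' y) := by
        rw [← Scheme.Hom.comp_apply, ← Scheme.Hom.comp_apply, h.w]
      ext y
      rw [Scheme.Pullback.range_fst, Scheme.Pullback.range_snd, Set.mem_preimage, Set.mem_preimage,
        Set.mem_preimage, Set.mem_preimage, hw]
    rw [this]
    exact hd.preimage g'.isOpenMap

end Clopen

/-! ### Radiciality from the normalization -/

section Radicial

open Limits TensorProduct

variable {X Y U : Scheme.{u}}

theorem isPullback_fromSpec (p : Y ⟶ X) [IsAffineHom p] {V : X.Opens} (hV : IsAffineOpen V) :
    IsPullback (hV.preimage p).fromSpec (Spec.map (p.app V)) p hV.fromSpec := by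
  refine (isPullback_morphismRestrict p V).flip.of_iso (hV.preimage p).isoSpec (.refl _) hV.isoSpec
    (.refl _) ?_ ?_ ?_ ?_
  · simp [IsAffineOpen.isoSpec_hom]
  · rw [← cancel_mono hV.fromSpec]
    simp [IsAffineOpen.isoSpec_hom, Scheme.Hom.app_eq_appLE]
  · simp
  · simp [IsAffineOpen.isoSpec_hom]

/-- A finite morphism `p : Y ⟶ X` that is a universal homeomorphism over the open subscheme `U`,
with `p⁻¹(U)` dense, is radicial as soon as the normalization of `X` in `U` is universally
homeomorphic to `X`. -/
theorem universallyInjective_of_isUniversalHomeomorphism_normalization (f : U ⟶ X)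
    [IsOpenImmersion f] [QuasiCompact f] (hf : IsUniversalHomeomorphism f.fromNormalization)
    (p : Y ⟶ X) [IsFinite p] (hp : IsUniversalHomeomorphism (pullback.snd p f))
    (hd : Dense (p ⁻¹' Set.range f)) : UniversallyInjective p := by
  refine universallyInjective_of_forall_isAffineOpen p fun V hV K _ _ g₁ g₂ h ↦ ?_
  have hfin : (p.app V).hom.Finite := p.finite_app V hV
  algebraize [(p.app V).hom, (p.app V ≫ g₁).hom]
  let γ₁ : Γ(Y, p ⁻¹ᵁ V) →ₐ[Γ(X, V)] K := { g₁.hom with commutes' _ := rfl }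
  let γ₂ : Γ(Y, p ⁻¹ᵁ V) →ₐ[Γ(X, V)] K :=
    { g₂.hom with commutes' a := congr($h a).symm }
  suffices γ₁ = γ₂ by
    ext x
    exact congr($this x)
  refine eq_of_comap_injective_of_etale (comap_injective_of_isIdempotentElem ?_) γ₁ γ₂
  intro E _ _ _ e he P Q hPQ heP
  let φ : Γ(X, V) ⟶ .of E := CommRingCat.ofHom (algebraMap Γ(X, V) E)
  have : Etale (Spec.map φ) := HasRingHomProperty.Spec_iff.mpr
    (RingHom.etale_algebraMap.mpr ‹Algebra.Etale Γ(X, V) E›)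
  have h1 := (isPullback_SpecMap_of_isPushout _ _ _ _
    (CommRingCat.isPushout_tensorProduct Γ(X, V) E Γ(Y, p ⁻¹ᵁ V))).flip
  have h2 := h1.paste_horiz (isPullback_fromSpec p hV)
  obtain ⟨W, -, hW⟩ := exists_isClopen_preimage_eq_of_etale f hf p hp hd h2
    (V := (PrimeSpectrum.basicOpen e : Set (PrimeSpectrum (E ⊗[Γ(X, V)] Γ(Y, p ⁻¹ᵁ V)))))
    (PrimeSpectrum.isClopen_iff.mpr ⟨e, he, rfl⟩)
  by_contra heQ
  have hQ : Q ∈ (PrimeSpectrum.basicOpen e : Set (PrimeSpectrum (E ⊗[Γ(X, V)] Γ(Y, p ⁻¹ᵁ V)))) :=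
    heQ
  have hP : P ∈ (PrimeSpectrum.basicOpen e : Set (PrimeSpectrum (E ⊗[Γ(X, V)] Γ(Y, p ⁻¹ᵁ V)))) := by
    rw [← hW] at hQ ⊢
    change PrimeSpectrum.comap (algebraMap E (E ⊗[Γ(X, V)] Γ(Y, p ⁻¹ᵁ V))) Q ∈ W at hQ
    change PrimeSpectrum.comap (algebraMap E (E ⊗[Γ(X, V)] Γ(Y, p ⁻¹ᵁ V))) P ∈ W
    rwa [hPQ]
  exact hP heP

end Radicial

/-! ### Integral elements with bounded denominators -/

section BoundedIntegralClosure

/-- The ideal of denominators of `x : G`: the elements `a` of `A` such that `a • x` lies in the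
image of `A`. -/
def denominatorIdeal (A : Type*) {G : Type*} [CommRing A] [CommRing G] [Algebra A G] (x : G) :
    Ideal A :=
  (Subalgebra.toSubmodule (⊥ : Subalgebra A G)).comap (LinearMap.toSpanSingleton A G x)

/-- The subalgebra of `G` generated by the elements integral over `A` whose ideal of denominators
contains `J`. Such elements form a module but need not be closed under multiplication, hence the
`adjoin`. -/
def boundedIntegralClosure (A G : Type*) [CommRing A] [CommRing G] [Algebra A G] (J : Ideal A) :
    Subalgebra A G :=
  Algebra.adjoin A {x | IsIntegral A x ∧ J ≤ denominatorIdeal A x}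

variable {A G : Type*} [CommRing A] [CommRing G] [Algebra A G] {J : Ideal A}

theorem mul_mem_denominatorIdeal_iff {a s : A} {x : G} :
    s * a ∈ denominatorIdeal A x ↔ a ∈ denominatorIdeal A (s • x) := by
  simp [denominatorIdeal, mul_smul, smul_comm s a]

theorem mem_denominatorIdeal {a : A} {x : G} :
    a ∈ denominatorIdeal A x ↔ ∃ c : A, algebraMap A G c = a • x := Iff.rfl

theorem boundedIntegralClosure_le_integralClosure :
    boundedIntegralClosure A G J ≤ integralClosure A G :=
  Algebra.adjoin_le fun _ hx ↦ hx.1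

/-- For finitely generated `J`, an integral element all of whose products with high powers of
elements of `J` lie in the image of `A` has denominators containing a power of `J`. -/
theorem exists_mem_boundedIntegralClosure_pow (hJ : J.FG) {x : G} (hx : IsIntegral A x)
    (h : ∀ a ∈ J, ∃ k : ℕ, a ^ k ∈ denominatorIdeal A x) :
    ∃ n : ℕ, x ∈ boundedIntegralClosure A G (J ^ n) := by
  obtain ⟨n, hn⟩ := Ideal.exists_pow_le_of_le_radical_of_fg (I := J)
    (J := denominatorIdeal A x) (fun a ha ↦ h a ha) hJ
  exact ⟨n, Algebra.subset_adjoin ⟨hx, hn⟩⟩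

/-- If no nonzero element of `G` is killed by `J`, multiplication by a finite set of generators of
`J` embeds the module of generators of `boundedIntegralClosure A G J` into a finite power of the
image of `A`. So that module is finite over the Noetherian ring `A`, and the algebra is generated by
finitely many integral elements. -/
theorem finite_boundedIntegralClosure [IsNoetherianRing A]
    (h : ∀ x : G, (∀ a ∈ J, a • x = 0) → x = 0) :
    Module.Finite A (boundedIntegralClosure A G J) := by
  let L : Submodule A G := Subalgebra.toSubmodule (⊥ : Subalgebra A G)
  have hL : IsNoetherian A L := by
    have : Function.Surjective (Algebra.linearMap A (⊥ : Subalgebra A G)) := by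
      rintro ⟨_, a, rfl⟩
      exact ⟨a, rfl⟩
    exact isNoetherian_of_surjective _ (LinearMap.range_eq_top.mpr this)
  obtain ⟨S, hS⟩ := IsNoetherian.noetherian J
  -- The generators of the algebra form a submodule `M`, which `ψ` embeds into a power of `L`.
  let M : Submodule A G :=
    { carrier := {x | IsIntegral A x ∧ J ≤ denominatorIdeal A x}
      add_mem' := fun hx hy ↦ ⟨hx.1.add hy.1, fun a ha ↦ by
        have := L.add_mem (hx.2 ha) (hy.2 ha)
        simpa [denominatorIdeal, L] using this⟩
      zero_mem' := ⟨isIntegral_zero, fun a _ ↦ by simp [denominatorIdeal]⟩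
      smul_mem' := fun c x hx ↦ ⟨hx.1.smul c, fun a ha ↦ by
        have := L.smul_mem c (hx.2 ha)
        simpa [denominatorIdeal, smul_comm a c, L] using this⟩ }
  let ψ : M →ₗ[A] (S → L) := LinearMap.pi fun s ↦
    { toFun x := ⟨(s : A) • (x : G), x.2.2 (hS ▸ Submodule.subset_span s.2)⟩
      map_add' x y := by ext; simp
      map_smul' c x := by ext; simp [smul_comm (s : A) c] }
  have hψ : Function.Injective ψ := by
    rw [← LinearMap.ker_eq_bot, LinearMap.ker_eq_bot']
    intro x hx
    ext
    refine h x fun a ha ↦ ?_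
    rw [← hS] at ha
    induction ha using Submodule.span_induction with
    | mem s hs => exact congr(($hx ⟨s, hs⟩ : G))
    | zero => simp
    | add a b _ _ ha hb => rw [add_smul, ha, hb, add_zero]
    | smul a b _ hb => rw [smul_assoc, hb, smul_zero]
  have hM : IsNoetherian A M := isNoetherian_of_injective ψ hψ
  obtain ⟨t, ht⟩ := (isNoetherian_submodule.mp hM) M le_rfl
  have hadj : boundedIntegralClosure A G J = Algebra.adjoin A (t : Set G) := by
    apply le_antisymm
    · refine Algebra.adjoin_le fun x hx ↦ ?_
      have : x ∈ Submodule.span A (t : Set G) := ht ▸ hx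
      exact Algebra.span_le_adjoin A _ this
    · exact Algebra.adjoin_mono fun x hx ↦ (ht ▸ Submodule.subset_span hx : x ∈ M)
  rw [hadj]
  exact Algebra.finite_adjoin_of_finite_of_isIntegral t.finite_toSet fun x hx ↦
    (ht ▸ Submodule.subset_span hx : x ∈ M).1

section Localization

variable {A' G' : Type*} [CommRing A'] [CommRing G'] [Algebra A' G'] [Algebra A A']
  [Algebra G G'] [Algebra A G'] [IsScalarTower A A' G'] [IsScalarTower A G G']

theorem algebraMap_mem_boundedIntegralClosure {J' : Ideal A'} (hJ' : J.map (algebraMap A A') = J')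
    {x : G} (hx : x ∈ boundedIntegralClosure A G J) :
    algebraMap G G' x ∈ boundedIntegralClosure A' G' J' := by
  subst hJ'
  let T : Subalgebra A G :=
    ((boundedIntegralClosure A' G' (J.map (algebraMap A A'))).restrictScalars A).comap
      (IsScalarTower.toAlgHom A G G')
  refine (Algebra.adjoin_le (S := T) fun x hx ↦ ?_) hx
  refine Algebra.subset_adjoin ⟨(hx.1.map (IsScalarTower.toAlgHom A G G')).tower_top, ?_⟩
  rw [Ideal.map_le_iff_le_comap]
  intro a ha
  obtain ⟨c, hc⟩ := mem_denominatorIdeal.mp (hx.2 ha)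
  refine mem_denominatorIdeal.mpr ⟨algebraMap A A' c, ?_⟩
  rw [← IsScalarTower.algebraMap_apply, IsScalarTower.algebraMap_apply A G G', hc,
    algebraMap_smul]
  exact map_smul (IsScalarTower.toAlgHom A G G') a x

/-- Surjectivity half of the compatibility with localization: an element bounded by the localized
ideal becomes, after multiplication by a power of `r`, the image of one bounded by `J`. -/
theorem exists_algebraMap_eq_pow_smul (r : A) [IsLocalization.Away r A']
    [IsLocalization.Away (algebraMap A G r) G'] (hJ : J.FG) {x : G'}
    (hx : x ∈ boundedIntegralClosure A' G' (J.map (algebraMap A A'))) :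
    ∃ (n : ℕ), ∃ y ∈ boundedIntegralClosure A G J, algebraMap G G' y = r ^ n • x := by
  have hsmul (a : A) (y : G) : algebraMap G G' (a • y) = a • algebraMap G G' y :=
    map_smul (IsScalarTower.toAlgHom A G G') a y
  induction hx using Algebra.adjoin_induction with
  | mem x hx =>
    obtain ⟨hint, hden⟩ := hx
    obtain ⟨n, y₀, hy₀⟩ := IsLocalization.Away.surj (algebraMap A G r) x
    obtain ⟨⟨_, m, rfl⟩, hm⟩ := hint.exists_multiple_integral_of_isLocalization (M := .powers r)
    have hy₁ : algebraMap G G' (r ^ m • y₀) = r ^ n • (r ^ m • x) := by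
      rw [hsmul, ← hy₀, mul_comm, ← map_pow, ← map_pow, ← IsScalarTower.algebraMap_apply,
        ← Algebra.smul_def, smul_comm]
    obtain ⟨k, hk⟩ := IsLocalization.Away.exists_isIntegral_mul_of_isIntegral_algebraMap
      (r := algebraMap A G r) (Sₘ := G') isIntegral_algebraMap
      (x := r ^ m • y₀) (hy₁ ▸ (IsIntegral.smul (r ^ n) hm))
    rw [← map_pow, ← Algebra.smul_def, smul_smul] at hk
    set z := (r ^ k * r ^ m) • y₀ with hz
    have hz' : algebraMap G G' z = r ^ (k + n + m) • x := by
      rw [hz, mul_smul, hsmul, hy₁, smul_smul, smul_smul, pow_add, pow_add, mul_assoc]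
    -- The denominators of `z` contain `J` only up to powers of `r`, uniformly so as `J` is finite.
    have hloc (a : A) (ha : a ∈ J) : ∃ l, r ^ l * a ∈ denominatorIdeal A z := by
      obtain ⟨a', ha'⟩ := mem_denominatorIdeal.mp (hden (Ideal.mem_map_of_mem _ ha))
      obtain ⟨p, c, hc⟩ := IsLocalization.Away.surj r a'
      have h0 : algebraMap G G' ((r ^ p * a) • z) =
          algebraMap G G' (algebraMap A G (r ^ (k + n + m) * c)) := by
        rw [hsmul, hz', ← IsScalarTower.algebraMap_apply, map_mul, ← Algebra.smul_def,
          IsScalarTower.algebraMap_apply A A' G' c, ← hc, map_mul, ha', mul_comm, ← map_pow,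
          ← IsScalarTower.algebraMap_apply, algebraMap_smul]
        simp only [Algebra.smul_def, map_mul]
        ring
      obtain ⟨⟨_, l, rfl⟩, hl⟩ := (IsLocalization.eq_iff_exists
        (.powers (algebraMap A G r)) G').mp h0
      replace hl : algebraMap A G r ^ l * ((r ^ p * a) • z) =
        algebraMap A G r ^ l * algebraMap A G (r ^ (k + n + m) * c) := hl
      refine ⟨l + p, mem_denominatorIdeal.mpr ⟨r ^ l * (r ^ (k + n + m) * c), ?_⟩⟩
      rw [map_mul, map_pow]
      refine hl.symm.trans ?_
      rw [← map_pow, ← Algebra.smul_def, smul_smul, ← mul_assoc, pow_add]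
    choose! l hl using hloc
    obtain ⟨S, hS⟩ := hJ
    refine ⟨S.sup l + (k + n + m), r ^ S.sup l • z, Algebra.subset_adjoin ⟨hk.smul _, ?_⟩, ?_⟩
    · rw [← hS]
      refine Ideal.span_le.mpr fun a ha ↦ mul_mem_denominatorIdeal_iff.mp ?_
      obtain ⟨d, hd⟩ := Nat.exists_eq_add_of_le (Finset.le_sup (f := l) ha)
      rw [hd, add_comm, pow_add, mul_assoc]
      exact Ideal.mul_mem_left _ _ (hl a (hS ▸ Submodule.subset_span ha))
    · rw [hsmul, hz', smul_smul, ← pow_add]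
  | algebraMap a =>
    obtain ⟨n, c, hc⟩ := IsLocalization.Away.surj r a
    refine ⟨n, algebraMap A G c, Subalgebra.algebraMap_mem _ _, ?_⟩
    rw [← IsScalarTower.algebraMap_apply, Algebra.smul_def, IsScalarTower.algebraMap_apply A A' G',
      ← hc, IsScalarTower.algebraMap_apply A A' G', map_mul, mul_comm]
    simp only [map_pow]
  | add x y _ _ hx hy =>
    obtain ⟨n, x', hx', hx⟩ := hx
    obtain ⟨m, y', hy', hy⟩ := hy
    refine ⟨n + m, r ^ m • x' + r ^ n • y', add_mem (Subalgebra.smul_mem _ hx' _)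
      (Subalgebra.smul_mem _ hy' _), ?_⟩
    rw [map_add, hsmul, hsmul, hx, hy]
    simp only [smul_add, smul_smul, pow_add, mul_comm]
  | mul x y _ _ hx hy =>
    obtain ⟨n, x', hx', hx⟩ := hx
    obtain ⟨m, y', hy', hy⟩ := hy
    refine ⟨n + m, x' * y', mul_mem hx' hy', ?_⟩
    rw [map_mul, hx, hy, smul_mul_smul_comm, pow_add]

theorem isLocalization_boundedIntegralClosure (r : A) [IsLocalization.Away r A']
    [IsLocalization.Away (algebraMap A G r) G'] (hJ : J.FG) {J' : Ideal A'}
    (hJ' : J.map (algebraMap A A') = J')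
    [Algebra (boundedIntegralClosure A G J) (boundedIntegralClosure A' G' J')]
    (h : ∀ x : boundedIntegralClosure A G J, (algebraMap (boundedIntegralClosure A G J)
      (boundedIntegralClosure A' G' J') x : G') = algebraMap G G' x) :
    IsLocalization.Away (algebraMap A (boundedIntegralClosure A G J) r)
      (boundedIntegralClosure A' G' J') := by
  subst hJ'
  have hr : algebraMap (boundedIntegralClosure A G J)
      (boundedIntegralClosure A' G' (J.map (algebraMap A A'))) (algebraMap A _ r) =
        algebraMap A' _ (algebraMap A A' r) := by
    ext
    rw [h, Subalgebra.coe_algebraMap, Subalgebra.coe_algebraMap, ← IsScalarTower.algebraMap_apply,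
      ← IsScalarTower.algebraMap_apply]
  refine ⟨?_, ?_, ?_⟩
  · rintro ⟨_, n, rfl⟩
    simp only [map_pow, hr]
    exact ((IsLocalization.Away.algebraMap_isUnit (S := A') r).map _).pow n
  · intro x
    obtain ⟨n, y, hy, hxy⟩ := exists_algebraMap_eq_pow_smul (G := G) r hJ x.2
    refine ⟨⟨⟨y, hy⟩, ⟨_, n, rfl⟩⟩, ?_⟩
    ext
    simp only [map_pow, hr, h, hxy]
    simp [Algebra.smul_def, mul_comm, IsScalarTower.algebraMap_apply A A' G']
  · intro x y hxy
    have : algebraMap G G' x = algebraMap G G' y := by rw [← h, ← h, hxy]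
    obtain ⟨⟨_, n, rfl⟩, hn⟩ := (IsLocalization.eq_iff_exists
        (.powers (algebraMap A G r)) G').mp this
    refine ⟨⟨_, n, rfl⟩, ?_⟩
    ext
    simpa using hn

end Localization

end BoundedIntegralClosure

/-! ### Relative spectrum of a quasi-coherent algebra -/

section RelativeSpec

open Limits Scheme.AffineZariskiSite

variable {X : Scheme.{u}} {F : X.AffineZariskiSiteᵒᵖ ⥤ CommRingCat.{u}}
  {α : (toOpensFunctor X).op ⋙ X.presheaf ⟶ F}

/-- A quasi-coherent algebra on `X`, given on affine opens, is the algebra of sections of a scheme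
affine over `X`, its relative spectrum. -/
theorem exists_isAffineHom_app_eq (H : α.Coequifibered) :
    ∃ (T : Scheme.{u}) (π : T ⟶ X), IsAffineHom π ∧ ∀ W : X.AffineZariskiSite,
      ∃ e : Γ(T, π ⁻¹ᵁ W.toOpens) ≅ F.obj (.op W), π.app W.toOpens ≫ e.hom = α.app (.op W) := by
  let d := relativeGluingData H
  have : (d.functor ⋙ Scheme.forget).IsLocallyDirected :=
    Scheme.Cover.RelativeGluingData.instIsLocallyDirectedI₀CompFunctorForgetOfIsThin ..
  have hpb (W : X.AffineZariskiSite) (hW : IsAffineOpen W.toOpens) :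
      IsPullback (colimit.ι d.functor W) (Spec.map (α.app (.op W))) d.toBase hW.fromSpec := by
    have h0 := (d.isPullback_natTrans_ι_toBase W).flip
    have h1 : d.natTrans.app W = Spec.map (α.app (.op W)) ≫ hW.isoSpec.inv := rfl
    refine h0.of_iso (.refl _) (.refl _) hW.isoSpec (.refl _) ?_ ?_ ?_ ?_
    · simp
    · rw [h1]
      exact (Category.assoc _ _ _).trans ((congrArg (Spec.map (α.app (.op W)) ≫ ·)
        hW.isoSpec.inv_hom_id).trans ((Category.comp_id _).trans (Category.id_comp _).symm))
    · simp
    · exact (Category.comp_id _).trans hW.isoSpec_hom_fromSpec.symm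
  have haff : IsAffineHom d.toBase := by
    refine isAffineHom_of_forall_exists_isAffineOpen d.toBase fun x ↦ ?_
    obtain ⟨_, ⟨V, hV, rfl⟩, hxV, -⟩ :=
      X.isBasis_affineOpens.exists_subset_of_mem_open (Set.mem_univ x) isOpen_univ
    replace hV : IsAffineOpen V := hV
    refine ⟨V, hxV, hV, ?_⟩
    have : IsAffine (d.functor.obj ⟨V, hV⟩) := inferInstanceAs (IsAffine (Spec _))
    have : IsOpenImmersion (colimit.ι d.functor ⟨V, hV⟩) :=
      MorphismProperty.of_isPullback (hpb ⟨V, hV⟩ hV).flip hV.isOpenImmersion_fromSpec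
    have h2 : d.toBase ⁻¹ᵁ V = (colimit.ι d.functor ⟨V, hV⟩).opensRange := by
      refine TopologicalSpace.Opens.ext (Eq.trans ?_ (d.preimage_toBase_eq_range_ι ⟨V, hV⟩))
      exact congrArg (d.toBase ⁻¹' ·) (Scheme.Opens.range_ι V).symm
    rw [h2]
    exact isAffineOpen_opensRange _
  refine ⟨d.glued, d.toBase, haff, fun W ↦ ?_⟩
  have h2 := isPullback_fromSpec d.toBase W.2
  let e : Spec (F.obj (.op W)) ≅ Spec Γ(d.glued, d.toBase ⁻¹ᵁ W.toOpens) :=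
    (hpb W W.2).isoIsPullback _ _ h2
  have he : e.hom ≫ Spec.map (d.toBase.app W.toOpens) = Spec.map (α.app (.op W)) :=
    (hpb W W.2).isoIsPullback_hom_snd _ _ h2
  refine ⟨(Scheme.Spec.preimageIso e).unop, ?_⟩
  apply Spec.map_injective
  refine (Spec.map_comp _ _).trans (Eq.trans ?_ he)
  exact congrArg (· ≫ Spec.map (d.toBase.app W.toOpens)) (Scheme.Spec.map_preimage e.hom)

end RelativeSpec

/-! ### The sheaf of integral sections with bounded denominators -/

section BoundedNormalization

open Limits Scheme.AffineZariskiSite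

variable {U X : Scheme.{u}} (f : U ⟶ X) (I : X.IdealSheafData)

/-- The presheaf, on the affine opens `W` of `X`, of the subalgebras of `Γ(U, f⁻¹(W))` generated by
the sections integral over `Γ(X, W)` whose denominators contain `I(W)`. -/
noncomputable def boundedNormalizationDiagram : X.AffineZariskiSiteᵒᵖ ⥤ CommRingCat.{u} where
  obj W :=
    letI := (f.app W.unop.toOpens).hom.toAlgebra
    .of (boundedIntegralClosure Γ(X, W.unop.toOpens) Γ(U, f ⁻¹ᵁ W.unop.toOpens)
      (I.ideal ⟨W.unop.toOpens, W.unop.2⟩))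
  map {V W} i :=
    CommRingCat.ofHom ((U.presheaf.map (homOfLE (f.preimage_mono
      (toOpens_mono i.unop.le))).op).hom.restrict _ _ fun x hx ↦ by
      obtain ⟨W, rfl⟩ := Opposite.op_surjective W
      obtain ⟨V, rfl⟩ := Opposite.op_surjective V
      have h : W.toOpens ≤ V.toOpens := toOpens_mono i.unop.le
      algebraize [(f.app W.toOpens).hom, (f.app V.toOpens).hom, (X.presheaf.map (homOfLE h).op).hom,
        (U.presheaf.map (homOfLE (f.preimage_mono h)).op).hom,
        (f.appLE V.toOpens (f ⁻¹ᵁ W.toOpens) (f.preimage_mono h)).hom]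
      have : IsScalarTower Γ(X, V.toOpens) Γ(X, W.toOpens) Γ(U, f ⁻¹ᵁ W.toOpens) :=
        .of_algebraMap_eq' <| by
          simp only [RingHom.algebraMap_toAlgebra, ← CommRingCat.hom_comp,
            Scheme.Hom.app_eq_appLE, Scheme.Hom.map_appLE]
      have : IsScalarTower Γ(X, V.toOpens) Γ(U, f ⁻¹ᵁ V.toOpens) Γ(U, f ⁻¹ᵁ W.toOpens) :=
        .of_algebraMap_eq' rfl
      exact algebraMap_mem_boundedIntegralClosure
        (I.map_ideal (U := ⟨W.toOpens, W.2⟩) (V := ⟨V.toOpens, V.2⟩) h) hx)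
  map_id W := by
    refine CommRingCat.hom_ext (RingHom.ext fun x ↦ Subtype.ext ?_)
    exact congr($(U.presheaf.map_id _) x.1)
  map_comp i j := by
    refine CommRingCat.hom_ext (RingHom.ext fun x ↦ Subtype.ext ?_)
    exact congr($(U.presheaf.map_comp (homOfLE (f.preimage_mono
      (toOpens_mono i.unop.le))).op (homOfLE (f.preimage_mono
      (toOpens_mono j.unop.le))).op) x.1)

/-- The structure map from the structure presheaf of `X` to the presheaf of integral sections
bounded by `I`. -/
noncomputable def boundedNormalizationDiagramMap :
    (toOpensFunctor X).op ⋙ X.presheaf ⟶ boundedNormalizationDiagram f I where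
  app W :=
    letI := (f.app W.unop.toOpens).hom.toAlgebra
    CommRingCat.ofHom (algebraMap Γ(X, W.unop.toOpens) (boundedIntegralClosure Γ(X, W.unop.toOpens)
      Γ(U, f ⁻¹ᵁ W.unop.toOpens) (I.ideal ⟨W.unop.toOpens, W.unop.2⟩)))
  naturality {V W} i := by
    ext x
    exact Subtype.ext congr($(f.naturality (homOfLE (toOpens_mono i.unop.le)).op) x)

theorem isLocalization_preimage_basicOpen [QuasiCompact f] [QuasiSeparated f] {W : X.Opens}
    (hW : IsAffineOpen W) (r : Γ(X, W)) {V : X.Opens} (hV : X.basicOpen r = V) (hVW : V ≤ W) :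
    letI := (U.presheaf.map (homOfLE (f.preimage_mono hVW)).op).hom.toAlgebra
    IsLocalization.Away (f.app W r) Γ(U, f ⁻¹ᵁ V) := by
  subst hV
  generalize_proofs h
  have h' := f.preimage_basicOpen r
  revert h h'
  generalize f ⁻¹ᵁ X.basicOpen r = V
  rintro h rfl
  exact isLocalization_basicOpen_of_qcqs (f.isCompact_preimage hW.isCompact)
    (f.isQuasiSeparated_preimage hW.isQuasiSeparated) (f.app _ r)

theorem coequifibered_boundedNormalizationDiagramMap [QuasiCompact f] [QuasiSeparated f]
    [IsLocallyNoetherian X] : (boundedNormalizationDiagramMap f I).Coequifibered := by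
  refine coequifibered_iff_forall_isLocalizationAway.mpr fun W r ↦ ?_
  obtain ⟨W, hW⟩ := W
  change Γ(X, W) at r
  have hle : X.basicOpen r ≤ W := X.basicOpen_le r
  let : Algebra Γ(X, W) Γ(U, f ⁻¹ᵁ W) := (f.app W).hom.toAlgebra
  let : Algebra Γ(X, X.basicOpen r) Γ(U, f ⁻¹ᵁ X.basicOpen r) :=
    (f.app (X.basicOpen r)).hom.toAlgebra
  let : Algebra (boundedIntegralClosure Γ(X, W) Γ(U, f ⁻¹ᵁ W) (I.ideal ⟨W, hW⟩))
      (boundedIntegralClosure Γ(X, X.basicOpen r) Γ(U, f ⁻¹ᵁ X.basicOpen r)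
        (I.ideal ⟨X.basicOpen r, hW.basicOpen r⟩)) :=
    ((boundedNormalizationDiagram f I).map (homOfLE
      (basicOpen_le ⟨W, hW⟩ r)).op).hom.toAlgebra
  let : Algebra Γ(U, f ⁻¹ᵁ W) Γ(U, f ⁻¹ᵁ X.basicOpen r) :=
    (U.presheaf.map (homOfLE (f.preimage_mono hle)).op).hom.toAlgebra
  let : Algebra Γ(X, W) Γ(X, X.basicOpen r) := (X.presheaf.map (homOfLE hle).op).hom.toAlgebra
  let : Algebra Γ(X, W) Γ(U, f ⁻¹ᵁ X.basicOpen r) :=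
    (f.appLE W (f ⁻¹ᵁ X.basicOpen r) (f.preimage_mono hle)).hom.toAlgebra
  have : IsScalarTower Γ(X, W) Γ(X, X.basicOpen r) Γ(U, f ⁻¹ᵁ X.basicOpen r) :=
    .of_algebraMap_eq' <| by
      simp only [RingHom.algebraMap_toAlgebra, ← CommRingCat.hom_comp,
        Scheme.Hom.app_eq_appLE, Scheme.Hom.map_appLE]
  have : IsScalarTower Γ(X, W) Γ(U, f ⁻¹ᵁ W) Γ(U, f ⁻¹ᵁ X.basicOpen r) :=
    .of_algebraMap_eq' rfl
  have : IsLocalization.Away r Γ(X, X.basicOpen r) := hW.isLocalization_basicOpen r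
  have : IsLocalization.Away (algebraMap Γ(X, W) Γ(U, f ⁻¹ᵁ W) r) Γ(U, f ⁻¹ᵁ X.basicOpen r) :=
    isLocalization_preimage_basicOpen f hW r rfl hle
  have : IsNoetherianRing Γ(X, W) := IsLocallyNoetherian.component_noetherian ⟨W, hW⟩
  exact isLocalization_boundedIntegralClosure (A := Γ(X, W)) (G := Γ(U, f ⁻¹ᵁ W))
    (A' := Γ(X, X.basicOpen r)) (G' := Γ(U, f ⁻¹ᵁ X.basicOpen r))
    (J' := I.ideal ⟨X.basicOpen r, hW.basicOpen r⟩) r ((isNoetherianRing_iff_ideal_fg _).mp this _)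
    (I.map_ideal (U := ⟨X.basicOpen r, hW.basicOpen r⟩) (V := ⟨W, hW⟩) hle) fun x ↦ rfl

end BoundedNormalization

/-! ### Associated points -/

section AssociatedPoint

variable {Y : Scheme.{u}} {V : Y.Opens}

/-- An associated point `y` in an affine open `V` corresponds to a prime ideal of `Γ(Y, V)`, the
sections vanishing at `y`, that is the annihilator of some section `b`. -/
theorem IsAssociatedPoint.exists_mul_eq_zero_iff (hV : IsAffineOpen V) [IsNoetherianRing Γ(Y, V)]
    {y : Y} (hy : y ∈ V) (h : IsAssociatedPoint y) :
    ∃ b : Γ(Y, V), ∀ s : Γ(Y, V), s * b = 0 ↔ y ∉ Y.basicOpen s := by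
  let := Y.presheaf.algebra_section_stalk ⟨y, hy⟩
  have := hV.isLocalization_stalk ⟨y, hy⟩
  have h1 := open Module.associatedPrimes in
    comap_mem_associatedPrimes_of_mem_associatedPrimes_of_isLocalizedModule_of_fg
    (hV.primeIdealOf ⟨y, hy⟩).asIdeal.primeCompl (Algebra.linearMap Γ(Y, V) (Y.presheaf.stalk y))
    (IsLocalRing.maximalIdeal (Y.presheaf.stalk y)) h ((isNoetherianRing_iff_ideal_fg _).mp ‹_› _)
  obtain ⟨b, hb⟩ := (isAssociatedPrime_iff.mp h1).2
  refine ⟨b, fun s ↦ ?_⟩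
  rw [Y.mem_basicOpen _ _ hy]
  have : s ∈ (IsLocalRing.maximalIdeal (Y.presheaf.stalk y)).comap
    (algebraMap Γ(Y, V) (Y.presheaf.stalk y)) ↔ s * b = 0 := by
    rw [hb, Submodule.mem_colon_singleton, Submodule.mem_bot, smul_eq_mul]
  exact this.symm

theorem exists_isAssociatedPoint_mem (hV : IsAffineOpen V) [IsNoetherianRing Γ(Y, V)]
    (hne : (V : Set Y).Nonempty) : ∃ y ∈ V, IsAssociatedPoint y := by
  have : Nonempty V := hne.to_subtype
  have : Nontrivial Γ(Y, V) := inferInstance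
  obtain ⟨Q, hQ⟩ := associatedPrimes.nonempty Γ(Y, V) Γ(Y, V)
  obtain ⟨y, hy⟩ : ∃ y : V, hV.primeIdealOf y = ⟨Q, hQ.isPrime⟩ :=
    ⟨hV.isoSpec.inv ⟨Q, hQ.isPrime⟩, congr($(hV.isoSpec.inv_hom_id) ⟨Q, hQ.isPrime⟩)⟩
  obtain rfl : (hV.primeIdealOf y).asIdeal = Q := congrArg PrimeSpectrum.asIdeal hy
  refine ⟨y, y.2, ?_⟩
  let := Y.presheaf.algebra_section_stalk y
  have := hV.isLocalization_stalk y
  refine open Module.associatedPrimes in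
    mem_associatedPrimes_of_comap_mem_associatedPrimes_of_isLocalizedModule
    (hV.primeIdealOf y).asIdeal.primeCompl
    (Algebra.linearMap Γ(Y, V) (Y.presheaf.stalk (y : Y))) _ ?_
  have h := IsLocalization.AtPrime.under_maximalIdeal (Y.presheaf.stalk (y : Y))
    (hV.primeIdealOf y).asIdeal
  exact (congrArg (· ∈ associatedPrimes Γ(Y, V) Γ(Y, V)) h).mpr hQ

end AssociatedPoint

/-! ### Sections over the complement of a closed subset -/

section Complement

variable {U X : Scheme.{u}} (f : U ⟶ X) (I : X.IdealSheafData)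

/-- If `f` misses the support of `I`, a section killed by `I` is zero, because around each point
some element of `I` is invertible. -/
theorem eq_zero_of_forall_mem_ideal (hI : Disjoint (I.support : Set X) (Set.range f)) {W : X.Opens}
    (hW : IsAffineOpen W) (x : Γ(U, f ⁻¹ᵁ W)) (h : ∀ a ∈ I.ideal ⟨W, hW⟩, f.app W a * x = 0) :
    x = 0 := by
  refine TopCat.Presheaf.section_ext U.sheaf _ _ _ fun u hu ↦ ?_
  have h1 : f u ∉ I.support := fun h ↦ Set.disjoint_left.mp hI h ⟨u, rfl⟩
  rw [Scheme.IdealSheafData.mem_support_iff_of_mem (U := ⟨W, hW⟩) hu] at h1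
  simp only [Scheme.mem_zeroLocus_iff, not_forall, not_not] at h1
  obtain ⟨a, ha, hua⟩ := h1
  have h2 : u ∈ U.basicOpen (f.app W a) := by
    rw [← f.preimage_basicOpen]
    exact hua
  rw [U.mem_basicOpen _ _ hu] at h2
  have h3 : U.presheaf.germ _ u hu (f.app W a) * U.presheaf.germ _ u hu x = 0 := by
    rw [← map_mul, h a ha, map_zero]
  exact (h2.mul_right_eq_zero.mp h3).trans (map_zero _).symm

theorem basicOpen_le_opensRange [IsOpenImmersion f]
    (hI : (Set.range f)ᶜ ⊆ I.support) {W : X.Opens}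
    (hW : IsAffineOpen W) {a : Γ(X, W)} (ha : a ∈ I.ideal ⟨W, hW⟩) :
    X.basicOpen a ≤ f.opensRange := by
  intro x hx
  by_contra hxf
  have := (Scheme.IdealSheafData.mem_support_iff_of_mem (U := ⟨W, hW⟩)
    (X.basicOpen_le a hx)).mp (hI hxf)
  exact (Scheme.mem_zeroLocus_iff ..).mp this a ha hx

theorem isIso_morphismRestrict_of_isIso_app {T : Scheme.{u}} (π : T ⟶ X) [IsAffineHom π]
    (V : X.Opens) (h : ∀ W ≤ V, IsAffineOpen W → IsIso (π.app W)) : IsIso (π ∣_ V) := by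
  refine IsZariskiLocalAtTarget.of_forall_exists_morphismRestrict
    (P := MorphismProperty.isomorphisms Scheme) fun x ↦ ?_
  obtain ⟨_, ⟨V', hV', rfl⟩, hxV, -⟩ :=
    V.toScheme.isBasis_affineOpens.exists_subset_of_mem_open (Set.mem_univ x) isOpen_univ
  replace hV' : IsAffineOpen V' := hV'
  refine ⟨V', hxV, ?_⟩
  have hW : IsAffineOpen (V.ι ''ᵁ V') := hV'.image_of_isOpenImmersion V.ι
  exact ((MorphismProperty.isomorphisms Scheme).arrow_mk_iso_iff
    (morphismRestrictRestrict π V V')).mpr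
    ((isIso_morphismRestrict_iff_isIso_app π hW).mpr (h _ (V.ι_image_le V') hW))

end Complement

/-! ### Finite modifications from bounded denominators -/

section FiniteModification

variable {U X Z : Scheme.{u}}

/-- The relative spectrum `T` of the sheaf of integral sections bounded by `I`. The map `ψ`
identifies the sections of `T` over an affine open `W` with the corresponding subalgebra of `Γ(U,
f⁻¹(W))`. -/
theorem exists_isAffineHom_range_eq_boundedIntegralClosure [IsLocallyNoetherian X] (f : U ⟶ X)
    [QuasiCompact f] [QuasiSeparated f] (I : X.IdealSheafData) :
    ∃ (T : Scheme.{u}) (π : T ⟶ X), IsAffineHom π ∧ ∀ (W : X.Opens) (hW : IsAffineOpen W),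
      ∃ ψ : Γ(T, π ⁻¹ᵁ W) ⟶ Γ(U, f ⁻¹ᵁ W), Function.Injective ψ ∧ π.app W ≫ ψ = f.app W ∧
        letI := (f.app W).hom.toAlgebra
        Set.range ψ = boundedIntegralClosure Γ(X, W) Γ(U, f ⁻¹ᵁ W) (I.ideal ⟨W, hW⟩) := by
  obtain ⟨T, π, hπ, H⟩ :=
    exists_isAffineHom_app_eq (coequifibered_boundedNormalizationDiagramMap f I)
  refine ⟨T, π, hπ, fun W hW ↦ ?_⟩
  obtain ⟨e, he⟩ := H ⟨W, hW⟩
  let := (f.app W).hom.toAlgebra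
  let R := boundedIntegralClosure Γ(X, W) Γ(U, f ⁻¹ᵁ W) (I.ideal ⟨W, hW⟩)
  let e' : Γ(T, π ⁻¹ᵁ W) ≅ .of R := e
  have he' : π.app W ≫ e'.hom = CommRingCat.ofHom (algebraMap Γ(X, W) R) := he
  have hb : Function.Bijective e'.hom := ConcreteCategory.bijective_of_isIso e'.hom
  refine ⟨e'.hom ≫ CommRingCat.ofHom R.val.toRingHom,
    Subtype.val_injective.comp hb.1, ?_, ?_⟩
  · rw [reassoc_of% he']
    rfl
  · change Set.range (Subtype.val ∘ e'.hom) = _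
    rw [Set.range_comp, hb.2.range_eq, Set.image_univ]
    exact Subtype.range_val

/-- The relative spectrum of the sheaf of integral sections over `X \ Z` bounded by an ideal
supported on `Z` is a finite modification centered at `Z`. -/
theorem isFiniteModification_of_range_eq_boundedIntegralClosure [IsLocallyNoetherian X] (i : Z ⟶ X)
    [IsClosedImmersion i] (I : X.IdealSheafData)
    (hI : Disjoint (I.support : Set X) (openComplement i)) {T : Scheme.{u}} (π : T ⟶ X)
    [IsAffineHom π]
    (H : ∀ (W : X.Opens) (hW : IsAffineOpen W),
      ∃ ψ : Γ(T, π ⁻¹ᵁ W) ⟶ Γ(openComplement i, (openComplement i).ι ⁻¹ᵁ W),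
        Function.Injective ψ ∧ π.app W ≫ ψ = (openComplement i).ι.app W ∧
        letI := ((openComplement i).ι.app W).hom.toAlgebra
        Set.range ψ = boundedIntegralClosure Γ(X, W)
          Γ(openComplement i, (openComplement i).ι ⁻¹ᵁ W) (I.ideal ⟨W, hW⟩)) :
    IsFiniteModification i π := by
  have hfin : IsFinite π := ⟨fun W hW ↦ by
    obtain ⟨ψ, hψ, hψ', hr⟩ := H W hW
    let := ((openComplement i).ι.app W).hom.toAlgebra
    let := (π.app W).hom.toAlgebra
    have : IsNoetherianRing Γ(X, W) := IsLocallyNoetherian.component_noetherian ⟨W, hW⟩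
    have hf := finite_boundedIntegralClosure (A := Γ(X, W))
      (G := Γ(openComplement i, (openComplement i).ι ⁻¹ᵁ W)) (J := I.ideal ⟨W, hW⟩) fun x hx ↦
        eq_zero_of_forall_mem_ideal (openComplement i).ι I
          (by rwa [Scheme.Opens.range_ι]) hW x hx
    let L : Γ(T, π ⁻¹ᵁ W) →ₗ[Γ(X, W)] boundedIntegralClosure Γ(X, W)
        Γ(openComplement i, (openComplement i).ι ⁻¹ᵁ W) (I.ideal ⟨W, hW⟩) :=
      { toFun b := ⟨ψ b, hr.le ⟨b, rfl⟩⟩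
        map_add' b c := Subtype.ext (map_add ψ.hom b c)
        map_smul' a b := Subtype.ext <| (map_mul ψ.hom _ b).trans
          congr($hψ' a * ψ b) }
    exact Module.Finite.of_injective L fun b c hbc ↦ hψ congr(($hbc).1)⟩
  have hT : IsLocallyNoetherian T := LocallyOfFiniteType.isLocallyNoetherian π
  refine ⟨hfin, fun y hy hyZ ↦ ?_, isIso_morphismRestrict_of_isIso_app π _ fun W hWU hW ↦ ?_⟩
  · obtain ⟨_, ⟨W, hW, rfl⟩, hyW, -⟩ :=
      X.isBasis_affineOpens.exists_subset_of_mem_open (Set.mem_univ (π y)) isOpen_univ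
    replace hW : IsAffineOpen W := hW
    have : IsNoetherianRing Γ(T, π ⁻¹ᵁ W) :=
      IsLocallyNoetherian.component_noetherian ⟨π ⁻¹ᵁ W, hW.preimage π⟩
    obtain ⟨b, hb⟩ := hy.exists_mul_eq_zero_iff (hW.preimage π) (V := π ⁻¹ᵁ W) hyW
    obtain ⟨ψ, hψ, hψ', -⟩ := H W hW
    have hsupp : (i.ker.support : Set X) = Set.range i := by
      rw [Scheme.Hom.support_ker, i.isClosedEmbedding.isClosed_range.closure_eq]
    have hker : ∀ a ∈ i.ker.ideal ⟨W, hW⟩, π.app W a * b = 0 := fun a ha ↦ by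
      refine (hb _).mpr fun h ↦ ?_
      rw [← π.preimage_basicOpen] at h
      have h1 := (Scheme.IdealSheafData.mem_support_iff_of_mem (U := ⟨W, hW⟩) hyW).mp
        (show π y ∈ (i.ker.support : Set X) from hsupp ▸ hyZ)
      exact (Scheme.mem_zeroLocus_iff ..).mp h1 a ha h
    -- The section `b` is killed by the ideal of `Z`, hence vanishes over the complement of `Z`.
    have hψb : ψ b = 0 := by
      refine eq_zero_of_forall_mem_ideal (openComplement i).ι i.ker ?_ hW _ fun a ha ↦ ?_
      · rw [Scheme.Opens.range_ι, hsupp]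
        exact disjoint_compl_right
      · rw [← hψ']
        exact (map_mul ψ.hom _ b).symm.trans (congr(ψ $(hker a ha)).trans (map_zero ψ.hom))
    have hb0 : b = 0 := hψ (hψb.trans (map_zero ψ.hom).symm)
    refine (hb 1).mp (by rw [hb0, mul_zero]) ?_
    rwa [Scheme.basicOpen_of_isUnit _ isUnit_one]
  · obtain ⟨ψ, hψ, hψ', -⟩ := H W hW
    have h1 : IsIso ((openComplement i).ι.app W) :=
      (openComplement i).ι.isIso_app W (by rwa [Scheme.Opens.opensRange_ι])
    have h2 : Function.Bijective ((openComplement i).ι.app W) :=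
      ConcreteCategory.bijective_of_isIso _
    have h3 : IsIso ψ := by
      rw [ConcreteCategory.isIso_iff_bijective]
      refine ⟨hψ, fun x ↦ ?_⟩
      obtain ⟨a, rfl⟩ := h2.2 x
      exact ⟨π.app W a, congr($hψ' a)⟩
    rw [← hψ'] at h1
    exact IsIso.of_isIso_comp_right _ ψ

end FiniteModification

/-! ### Denominators of sections over the complement -/

section Exhaustion

variable {U X Z : Scheme.{u}}

/-- If `f` is an isomorphism over the basic open set of `a`, then any section over `f⁻¹(W)` becomes
a section over `W` after multiplication by a power of `a`. -/
theorem exists_pow_mem_denominatorIdeal (f : U ⟶ X) [IsOpenImmersion f] [QuasiCompact f]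
    {W : X.Opens} (hW : IsAffineOpen W) {a : Γ(X, W)} (ha : X.basicOpen a ≤ f.opensRange)
    (x : Γ(U, f ⁻¹ᵁ W)) :
    letI := (f.app W).hom.toAlgebra
    ∃ k, a ^ k ∈ denominatorIdeal Γ(X, W) x := by
  have hle := X.basicOpen_le a
  let : Algebra Γ(X, W) Γ(U, f ⁻¹ᵁ W) := (f.app W).hom.toAlgebra
  let : Algebra Γ(U, f ⁻¹ᵁ W) Γ(U, f ⁻¹ᵁ X.basicOpen a) :=
    (U.presheaf.map (homOfLE (f.preimage_mono hle)).op).hom.toAlgebra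
  let : Algebra Γ(X, W) Γ(X, X.basicOpen a) := (X.presheaf.map (homOfLE hle).op).hom.toAlgebra
  have : IsLocalization.Away a Γ(X, X.basicOpen a) := hW.isLocalization_basicOpen a
  have : IsLocalization.Away (algebraMap Γ(X, W) Γ(U, f ⁻¹ᵁ W) a) Γ(U, f ⁻¹ᵁ X.basicOpen a) :=
    isLocalization_preimage_basicOpen f hW a rfl hle
  have h1 : IsIso (f.app (X.basicOpen a)) := f.isIso_app _ ha
  obtain ⟨c, hc⟩ := (ConcreteCategory.bijective_of_isIso (f.app (X.basicOpen a))).2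
    (algebraMap _ Γ(U, f ⁻¹ᵁ X.basicOpen a) x)
  obtain ⟨n, c', hc'⟩ := IsLocalization.Away.surj a c
  have hnat (b : Γ(X, W)) : f.app (X.basicOpen a) (algebraMap _ Γ(X, X.basicOpen a) b) =
      algebraMap _ Γ(U, f ⁻¹ᵁ X.basicOpen a) (algebraMap Γ(X, W) Γ(U, f ⁻¹ᵁ W) b) :=
    congr($(f.naturality (homOfLE hle).op) b)
  have h0 : algebraMap _ Γ(U, f ⁻¹ᵁ X.basicOpen a) (a ^ n • x) =
      algebraMap _ Γ(U, f ⁻¹ᵁ X.basicOpen a) (algebraMap Γ(X, W) Γ(U, f ⁻¹ᵁ W) c') := by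
    rw [Algebra.smul_def, map_mul, ← hnat, ← hnat, ← hc, ← hc', mul_comm, ← map_mul, map_pow]
  obtain ⟨⟨_, l, rfl⟩, hl⟩ := (IsLocalization.eq_iff_exists
    (.powers (algebraMap Γ(X, W) Γ(U, f ⁻¹ᵁ W) a)) _).mp h0
  refine ⟨l + n, mem_denominatorIdeal.mpr ⟨a ^ l * c', ?_⟩⟩
  rw [map_mul, map_pow, pow_add, mul_smul, Algebra.smul_def (a ^ l), map_pow]
  exact hl.symm

end Exhaustion

/-! ### Topologically normal pairs -/

section Main

open Limits

variable {X Z : Scheme.{u}}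

/-- The normalization of a topologically normal pair is radicial: every section of the normalization
comes from one of the finite modifications bounded by a power of the ideal of `Z`. -/
theorem universallyInjective_fromNormalization_of_isTopologicallyNormalPair [IsNoetherian X]
    (i : Z ⟶ X) [IsClosedImmersion i] (h : IsTopologicallyNormalPair i) :
    UniversallyInjective (openComplement i).ι.fromNormalization := by
  let U : Scheme.{u} := openComplement i
  let f : U ⟶ X := (openComplement i).ι
  have hsupp : (i.ker.support : Set X) = Set.range i := by
    rw [Scheme.Hom.support_ker, i.isClosedEmbedding.isClosed_range.closure_eq]
  refine universallyInjective_of_forall_isAffineOpen _ fun W hW K _ _ g₁ g₂ hg ↦ ?_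
  let := (f.app W).hom.toAlgebra
  let e : Γ(f.normalization, f.fromNormalization ⁻¹ᵁ W) ≅
    .of (integralClosure Γ(X, W) Γ(U, f ⁻¹ᵁ W)) := f.normalizationObjIso hW
  rw [← cancel_epi e.inv]
  ext x
  have hnoeth : IsNoetherianRing Γ(X, W) := IsLocallyNoetherian.component_noetherian ⟨W, hW⟩
  obtain ⟨n, hn⟩ := exists_mem_boundedIntegralClosure_pow (J := i.ker.ideal ⟨W, hW⟩)
    ((isNoetherianRing_iff_ideal_fg _).mp hnoeth _) x.2 fun a ha ↦
      exists_pow_mem_denominatorIdeal f hW (basicOpen_le_opensRange f i.ker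
        (by rw [hsupp, Scheme.Opens.range_ι]; exact (compl_compl _).le) hW ha) x.1
  obtain ⟨T, π, hπ, H⟩ := exists_isAffineHom_range_eq_boundedIntegralClosure f (i.ker ^ n)
  have hdisj : Disjoint ((i.ker ^ n).support : Set X) (openComplement i) := by
    refine Disjoint.mono_left ?_ (hsupp.symm ▸ disjoint_compl_right :
      Disjoint (i.ker.support : Set X) (openComplement i))
    rcases eq_or_ne n 0 with rfl | hn0
    · simp
    · rw [Scheme.IdealSheafData.support_pow _ _ hn0]
  have hu := h π (isFiniteModification_of_range_eq_boundedIntegralClosure i _ hdisj π H)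
  have : UniversallyInjective π := hu.universallyInjective
  obtain ⟨ψ, hψ, hψ', hr⟩ := H W hW
  -- The section `x` lies in the image of `T`, on which `g₁` and `g₂` agree as `π` is radicial.
  let χ : Γ(T, π ⁻¹ᵁ W) ⟶ .of (integralClosure Γ(X, W) Γ(U, f ⁻¹ᵁ W)) :=
    CommRingCat.ofHom (ψ.hom.codRestrict _ fun b ↦
      boundedIntegralClosure_le_integralClosure (hr.le ⟨b, rfl⟩))
  have hχ : π.app W ≫ χ = CommRingCat.ofHom (algebraMap Γ(X, W) _) := by
    refine CommRingCat.hom_ext (RingHom.ext fun a ↦ Subtype.ext ?_)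
    exact congr($hψ' a)
  have key : χ ≫ e.inv ≫ g₁ = χ ≫ e.inv ≫ g₂ := by
    refine app_comp_injective π hW _ _ ?_
    have h1 : f.fromNormalization.app W = CommRingCat.ofHom (algebraMap _ _) ≫ e.inv :=
      f.fromNormalization_app hW
    rw [reassoc_of% hχ, reassoc_of% hχ, ← reassoc_of% h1, ← reassoc_of% h1, hg]
  obtain ⟨b, hb⟩ := hr.ge hn
  have hbx : χ b = x := Subtype.ext hb
  rw [← hbx]
  exact congr($key b)

theorem surjective_of_isIntegralHom_of_dense {Y : Scheme.{u}} (p : Y ⟶ X) [IsIntegralHom p]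
    {D : Set X} (hD : Dense D) (h : D ⊆ Set.range p) : Surjective p :=
  ⟨Set.range_eq_univ.mp <| p.isClosedMap.isClosed_range.closure_eq ▸ (hD.mono h).closure_eq⟩

theorem dense_openComplement (i : Z ⟶ X) [IsClosedImmersion i]
    (hZ : IsNowhereDense (Set.range i)) : Dense (openComplement i : Set X) :=
  (isClosed_isNowhereDense_iff_compl.mp ⟨i.isClosedEmbedding.isClosed_range, hZ⟩).2

theorem isUniversalHomeomorphism_fromNormalization [IsNoetherian X]
    (i : Z ⟶ X) [IsClosedImmersion i] (hZ : IsNowhereDense (Set.range i))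
    (h : IsTopologicallyNormalPair i) :
    IsUniversalHomeomorphism (openComplement i).ι.fromNormalization := by
  have := universallyInjective_fromNormalization_of_isTopologicallyNormalPair i h
  have := surjective_of_isIntegralHom_of_dense (openComplement i).ι.fromNormalization
    (dense_openComplement i hZ) fun x hx ↦
      ⟨(openComplement i).ι.toNormalization ⟨x, hx⟩,
        congr($((openComplement i).ι.toNormalization_fromNormalization) ⟨x, hx⟩)⟩
  exact isUniversalHomeomorphism_of_universallyInjective _

theorem isUniversalHomeomorphism_snd_of_morphismRestrict {Y : Scheme.{u}} (p : Y ⟶ X)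
    (V : X.Opens) (h : IsUniversalHomeomorphism (p ∣_ V)) :
    IsUniversalHomeomorphism (pullback.snd p V.ι) := by
  have h1 := (isPullback_morphismRestrict p V).flip.isoPullback_inv_snd
  exact h1 ▸ (MorphismProperty.cancel_left_of_respectsIso
    (MorphismProperty.universally (topologically IsHomeomorph)) _ _).mpr h

/-- An open subset containing all associated points is dense, since every nonempty affine open
contains an associated point. -/
theorem dense_of_forall_isAssociatedPoint_mem {Y : Scheme.{u}} [IsLocallyNoetherian Y]
    {V : Y.Opens} (h : ∀ y, IsAssociatedPoint y → y ∈ V) : Dense (V : Set Y) := by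
  rw [dense_iff_inter_open]
  rintro W hW ⟨w, hw⟩
  obtain ⟨_, ⟨W', hW', rfl⟩, hwW, hle⟩ := Y.isBasis_affineOpens.exists_subset_of_mem_open hw hW
  have : IsNoetherianRing Γ(Y, W') := IsLocallyNoetherian.component_noetherian ⟨W', hW'⟩
  obtain ⟨y, hy, hya⟩ := exists_isAssociatedPoint_mem hW' ⟨w, hwW⟩
  exact ⟨y, hle hy, h y hya⟩

end Main

end NormalPairs

open NormalPairs in
theorem mainTheorem6 {Z X : Scheme.{u}} [AlgebraicGeometry.IsNoetherian X] (i : Z ⟶ X) [IsClosedImmersion i]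
    (hZ : IsNowhereDense (Set.range i)) :
    NormalPairs.IsTopologicallyNormalPair i ↔
      NormalPairs.IsStronglyTopologicallyNormalPair i := by
  refine ⟨fun h Y p hp ↦ ?_, fun h Y p hp ↦ ?_⟩
  · have := hp.isFinite
    have : IsLocallyNoetherian Y := LocallyOfFiniteType.isLocallyNoetherian p
    have hU := hp.isUniversalHomeomorphism_restrict
    have : Surjective p := surjective_of_isIntegralHom_of_dense p (dense_openComplement i hZ)
      fun x hx ↦ by
        obtain ⟨y, hy⟩ := hU.isHomeomorph.surjective ⟨x, hx⟩
        have h1 : p y.1 = ((p ∣_ openComplement i) y).1 :=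
          congr($(morphismRestrict_ι p (openComplement i)) y).symm
        exact ⟨y.1, h1.trans congr(($hy).1)⟩
    have : UniversallyInjective p :=
      universallyInjective_of_isUniversalHomeomorphism_normalization (openComplement i).ι
        (isUniversalHomeomorphism_fromNormalization i hZ h) p
        (isUniversalHomeomorphism_snd_of_morphismRestrict p _ hU) <| by
          rw [Scheme.Opens.range_ι]
          exact dense_of_forall_isAssociatedPoint_mem (V := p ⁻¹ᵁ openComplement i)
            hp.not_mem_of_isAssociatedPoint
    exact isUniversalHomeomorphism_of_universallyInjective p
  · have := hp.isIso_restrict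
    exact h p ⟨hp.isFinite, hp.not_mem_of_isAssociatedPoint, isUniversalHomeomorphism_of_isIso _⟩
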